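/- Let $\mathbb{R}^n\times\mathbb{R}^m$ carry the Euclidean norm, let $f\colon\mathbb{R}^n\times\mathbb{R}^m\to\mathbb{R}^n$ be of class $C^1$ in a neighborhood of $(0,0)$ with $f(0,0)=0$, and put $A=\nabla_x f(0,0)$, $B=\nabla_u f(0,0)$. Let $\Lambda_+(A)$ be the set of the complex eigenvalues $\lambda$ of $A$ with $\operatorname{Re}\lambda\ge 0$. Write $\mathbb{B}_r(z)$ for the closed ball with center $z$ and radius $r$. The mapping $f$ is called linearly open around $\bar z$ with modulus $\kappa>0$ if there is a neighborhood $U$ of $\bar z$ such that $\mathbb{B}_{\kappa r}(f(z))\subset f(\mathbb{B}_r(z))$ for all $z\in U$ and $r>0$ with $\mathbb{B}_r(z)\subset U$; it is called linearly open around $\bar z$ if this holds for some $\kappa>0$, and $\operatorname{cov} f(\bar z)\in[0,\infty]$ is the supremum of all such moduli $\kappa$ ($0$ if there are none). A continuous map $u\colon\mathbb{R}^n\to\mathbb{R}^m$ with $u(0)=0$ is said to locally exponentially stabilize the system $\dot x=f(x,u)$ if there are constants $\alpha,M,\delta>0$ such that for every $x_0\in\mathbb{R}^n$ with $\|x_0\|<\delta$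 the closed-loop system $\dot x=f(x,u(x))$ has a unique solution $x(\cdot)$ on $[0,\infty)$ with $x(0)=x_0$, and $\|x(t)\|\le Me^{-\alpha t}\|x_0\|$ for all $t\ge 0$. Here uniqueness means that every solution on an interval $[0,T)$, $T>0$, starting at $x_0$ coincides with $x(\cdot)$ on $[0,T)$. **Theorem 3.2.** (a) Suppose that $\Lambda_+(A)\subset\mathbb{R}$, that $f$ is linearly open around $(0,0)$, and that $\operatorname{cov} f(0,0)>\kappa$ for some constant $\kappa>0$ with $\kappa>\sup\Lambda_+(A)$, where $\sup\emptyset:=-\infty$. Then there is a continuous feedback law $u\colon\mathbb{R}^n\to\mathbb{R}^m$ with $u(0)=0$ that locally exponentially stabilizes $\dot x=f(x,u)$. (b) Conversely, without any assumption on $\Lambda_+(A)$ or on $\operatorname{cov} f(0,0)$: if some continuously differentiable feedback law $u\colon\mathbb{R}^n\to\mathbb{R}^m$ with $u(0)=0$ locally exponentially stabilizes $\dot x=f(x,u)$, then $f$ is linearly open around $(0,0)$, and $\operatorname{rank}[A\mid B]=n$. -/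

import Mathlib

open Set Filter Topology

noncomputable section

/-- `ℝⁿ × ℝᵐ` with the Euclidean norm `‖(x, u)‖² = ‖x‖² + ‖u‖²`. -/
abbrev StateControl (n m : ℕ) : Type :=
  WithLp 2 (EuclideanSpace ℝ (Fin n) × EuclideanSpace ℝ (Fin m))

/-- The covering property of `f` around `z₀` with modulus `κ > 0`: there is a neighborhood `U` of
`z₀` such that `𝔹_{κ r}(f z) ⊆ f(𝔹_r(z))` for all `z ∈ U` and `r > 0` with `𝔹_r(z) ⊆ U`, where
`𝔹` denotes closed balls. -/
def LinearlyOpenWith {Z Y : Type*} [PseudoMetricSpace Z] [PseudoMetricSpace Y]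
    (f : Z → Y) (z₀ : Z) (κ : ℝ) : Prop :=
  0 < κ ∧ ∃ U ∈ 𝓝 z₀, ∀ z ∈ U, ∀ r : ℝ, 0 < r → Metric.closedBall z r ⊆ U →
    Metric.closedBall (f z) (κ * r) ⊆ f '' Metric.closedBall z r

/-- `f` is linearly open around `z₀`: it has the covering property with some modulus. -/
def LinearlyOpen {Z Y : Type*} [PseudoMetricSpace Z] [PseudoMetricSpace Y]
    (f : Z → Y) (z₀ : Z) : Prop :=
  ∃ κ : ℝ, LinearlyOpenWith f z₀ κ

/-- The exact covering bound `cov f(z₀)`, the supremum in `[0, ∞]` of all moduli of linear openness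
of `f` around `z₀` (it is `0` if there are none). -/
def cov {Z Y : Type*} [PseudoMetricSpace Z] [PseudoMetricSpace Y]
    (f : Z → Y) (z₀ : Z) : ENNReal :=
  ⨆ (κ : ℝ) (_ : LinearlyOpenWith f z₀ κ), ENNReal.ofReal κ

/-- `A = ∇ₓ f(0, 0)`, the Jacobian matrix of `x ↦ f(x, 0)` at `0`. -/
def stateJacobian {n m : ℕ} (f : StateControl n m → EuclideanSpace ℝ (Fin n)) :
    Matrix (Fin n) (Fin n) ℝ :=
  Matrix.of fun i j =>
    fderiv ℝ (fun x : EuclideanSpace ℝ (Fin n) => f (WithLp.toLp 2 (x, 0))) 0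
      (EuclideanSpace.single j 1) i

/-- `B = ∇ᵤ f(0, 0)`, the Jacobian matrix of `u ↦ f(0, u)` at `0`. -/
def controlJacobian {n m : ℕ} (f : StateControl n m → EuclideanSpace ℝ (Fin n)) :
    Matrix (Fin n) (Fin m) ℝ :=
  Matrix.of fun i j =>
    fderiv ℝ (fun u : EuclideanSpace ℝ (Fin m) => f (WithLp.toLp 2 (0, u))) 0
      (EuclideanSpace.single j 1) i

/-- `Λ₊(A)`: the complex eigenvalues of the real matrix `A` with nonnegative real part. -/
def unstableSpectrum {n : ℕ} (A : Matrix (Fin n) (Fin n) ℝ) : Set ℂ :=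
  {μ | μ ∈ spectrum ℂ (A.map Complex.ofReal) ∧ 0 ≤ μ.re}

/-- `sup {λ | λ ∈ Λ₊(A)}` in the extended reals, with `sup ∅ = -∞`; the real part is taken only to
have an extended real number, as the bound is used for `Λ₊(A) ⊆ ℝ`. -/
def unstableBound {n : ℕ} (A : Matrix (Fin n) (Fin n) ℝ) : EReal :=
  sSup ((fun μ : ℂ => (μ.re : EReal)) '' unstableSpectrum A)

/-- The right-hand side `x ↦ f(x, u(x))` of the closed-loop system. -/
def closedLoop {n m : ℕ} (f : StateControl n m → EuclideanSpace ℝ (Fin n))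
    (u : EuclideanSpace ℝ (Fin n) → EuclideanSpace ℝ (Fin m)) :
    EuclideanSpace ℝ (Fin n) → EuclideanSpace ℝ (Fin n) :=
  fun x => f (WithLp.toLp 2 (x, u x))

/-- The stationary feedback law `u`, with `u(0) = 0`, exponentially stabilizes `ẋ = f(x, u)` locally
around the origin: for every `x₀` near `0` the closed-loop system has a solution `x` on `[0, ∞)`
with `x(0) = x₀`, this solution is unique (every solution on some `[0, T)` that starts at `x₀`
agrees with it there), and it satisfies `‖x(t)‖ ≤ M e^{-α t} ‖x₀‖` for all `t ≥ 0`. -/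
def LocallyExpStabilizes {n m : ℕ} (f : StateControl n m → EuclideanSpace ℝ (Fin n))
    (u : EuclideanSpace ℝ (Fin n) → EuclideanSpace ℝ (Fin m)) : Prop :=
  u 0 = 0 ∧ ∃ α > (0 : ℝ), ∃ M > (0 : ℝ), ∃ δ > (0 : ℝ),
    ∀ x₀ : EuclideanSpace ℝ (Fin n), ‖x₀‖ < δ →
      ∃ x : ℝ → EuclideanSpace ℝ (Fin n),
        x 0 = x₀ ∧ IsIntegralCurveOn x (fun _ => closedLoop f u) (Ici 0) ∧
        (∀ (T : ℝ) (y : ℝ → EuclideanSpace ℝ (Fin n)), 0 < T → y 0 = x₀ →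
          IsIntegralCurveOn y (fun _ => closedLoop f u) (Ico 0 T) → EqOn y x (Ico 0 T)) ∧
        ∀ t : ℝ, 0 ≤ t → ‖x t‖ ≤ M * Real.exp (-(α * t)) * ‖x₀‖

end

/-! Sufficiency. Suppose `p` is a left eigenvector of `A` with eigenvalue `l ≥ 0` and `pᵀB = 0`. To
first order `pᵀf(x, u) = l pᵀx`, so `f` stretches balls in the direction `p` by at most about `l`,
and no modulus above `l` is possible. Hence a modulus above all of `Λ₊(A)` gives Hautus' condition
at every unstable eigenvalue, each being real. Rank-one feedbacks built on left eigenvectors then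
move the unstable eigenvalues to `-1` one at a time (`Matrix.exists_feedback_of_hautus`). The
resulting Hurwitz matrix is strictly dissipative in a suitable Euclidean norm, and this norm is a
Lyapunov function for the nonlinear closed loop (`exists_exp_stable_of_dissipative_fderiv`).

Necessity. If the closed-loop linearization `J` were not onto, take `w ≠ 0` orthogonal to its range.
Then `⟪w, x⟫` changes only through the nonlinear remainder, so a small solution starting along `w`
cannot halve its size within a fixed time. Thus `J` is onto, and so is the derivative of `f`,
through which `J` factors. Lyusternik–Graves and linear algebra give the two conclusions. -/

open scoped NNReal

/-! ### Global existence and local uniqueness for autonomous equations. -/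

section ODE

variable {E : Type*} [NormedAddCommGroup E] [NormedSpace ℝ E]


/-- A bounded, globally Lipschitz autonomous vector field has integral curves on `[0, ∞)`. -/
theorem exists_isIntegralCurveOn_Ici [CompleteSpace E] {h : E → E} {K L : ℝ≥0}
    (hK : LipschitzWith K h) (hL : ∀ x, ‖h x‖ ≤ L) (x₀ : E) :
    ∃ x : ℝ → E, x 0 = x₀ ∧ IsIntegralCurveOn x (fun _ => h) (Ici 0) := by
  have key : ∀ n : ℕ, ∃ α : ℝ → E, α 0 = x₀ ∧
      ∀ t ∈ Icc (0 : ℝ) (n + 1), HasDerivWithinAt α (h (α t)) (Icc (0 : ℝ) (n + 1)) t := by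
    intro n
    have hn : (0 : ℝ) ≤ n + 1 := by positivity
    -- At speed at most `L`, the ball of radius `L * (n + 1)` cannot be left by time `n + 1`.
    have hp : IsPicardLindelof (fun _ => h) (tmin := 0) (tmax := n + 1) ⟨0, le_rfl, hn⟩ x₀
        (L * (n + 1)) 0 L K := by
      apply IsPicardLindelof.of_time_independent (fun x _ => hL x) hK.lipschitzOnWith
      simp [max_eq_left hn]
    exact hp.exists_eq_forall_mem_Icc_hasDerivWithinAt₀
  choose α hα0 hα using key
  have hcont : ∀ n, ContinuousOn (α n) (Icc 0 (n + 1)) := fun n t ht =>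
    (hα n t ht).continuousWithinAt
  have hright : ∀ n : ℕ, ∀ t ∈ Ico (0 : ℝ) (n + 1),
      HasDerivWithinAt (α n) (h (α n t)) (Ici t) t := fun n t ht =>
    (hα n t (Ico_subset_Icc_self ht)).mono_of_mem_nhdsWithin
      (mem_of_superset (Icc_mem_nhdsGE ht.2) (Icc_subset_Icc_left ht.1))
  have agree : ∀ n N : ℕ, n ≤ N → EqOn (α n) (α N) (Icc 0 (n + 1)) := by
    intro n N hnN
    have hle : (n : ℝ) + 1 ≤ N + 1 := by exact_mod_cast Nat.succ_le_succ hnN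
    exact ODE_solution_unique (v := fun _ => h) (fun _ => hK) (hcont n) (hright n)
      ((hcont N).mono (Icc_subset_Icc_right hle))
      (fun t ht => hright N t ⟨ht.1, ht.2.trans_le hle⟩) (by rw [hα0, hα0])
  refine ⟨fun t => α ⌊t⌋₊ t, by simp [hα0], fun t ht => ?_⟩
  have ht0 : (0 : ℝ) ≤ t := ht
  -- The glued function changes index at integers, but on all of `[0, N)` it equals the single curve
  -- `α N`, which settles differentiability at integer times too.
  set N := ⌊t⌋₊ + 1 with hN
  have htN : t < N := by rw [hN]; exact_mod_cast Nat.lt_floor_add_one t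
  have heq : EqOn (fun t => α ⌊t⌋₊ t) (α N) (Ico 0 N) := by
    intro s hs
    refine agree _ _ ?_ ⟨hs.1, (Nat.lt_floor_add_one s).le⟩
    exact ((Nat.floor_lt hs.1).2 hs.2).le
  have hmem : Ico (0 : ℝ) N ∈ 𝓝[Ici 0] t := by
    rw [← Ici_inter_Iio]
    exact inter_mem self_mem_nhdsWithin (mem_nhdsWithin_of_mem_nhds (Iio_mem_nhds htN))
  have h1 : HasDerivWithinAt (α N) (h (α N t)) (Ici 0) t :=
    (hα N t ⟨ht0, by linarith⟩).mono_of_mem_nhdsWithin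
      (mem_of_superset hmem fun s hs => ⟨hs.1, by linarith [hs.2]⟩)
  have h2 := h1.congr_of_eventuallyEq (heq.eventuallyEq_of_mem hmem) (heq ⟨ht0, htN⟩)
  rw [← heq ⟨ht0, htN⟩] at h2
  exact h2

/-- An integral curve that stays in an open set on which the vector field is Lipschitz is the only
one with its initial value. -/
theorem IsIntegralCurveOn.eqOn_Ico_of_lipschitzOnWith {g : E → E} {U : Set E} {K : ℝ≥0}
    (hU : IsOpen U) (hg : LipschitzOnWith K g U) {x y : ℝ → E} {T : ℝ}
    (hx : IsIntegralCurveOn x (fun _ => g) (Ico 0 T)) (hxU : ∀ t ∈ Ico 0 T, x t ∈ U)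
    (hy : IsIntegralCurveOn y (fun _ => g) (Ico 0 T)) (h0 : y 0 = x 0) :
    EqOn y x (Ico 0 T) := by
  have hright : ∀ z : ℝ → E, IsIntegralCurveOn z (fun _ => g) (Ico 0 T) →
      ∀ t ∈ Ico 0 T, HasDerivWithinAt z (g (z t)) (Ici t) t := fun z hz t ht =>
    (hz t ht).mono_of_mem_nhdsWithin
      (mem_of_superset (Ico_mem_nhdsGE ht.2) (Ico_subset_Ico_left ht.1))
  intro b hb
  have hsub : Icc 0 b ⊆ Ico 0 T := fun t ht => ⟨ht.1, ht.2.trans_lt hb.2⟩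
  have hclosed : IsClosed ({t | y t = x t} ∩ Icc 0 b) := by
    rw [inter_comm]
    exact ((hy.continuousOn.mono hsub).prodMk (hx.continuousOn.mono hsub)
      ).preimage_isClosed_of_isClosed isClosed_Icc isClosed_diagonal
  -- Continuous induction, since `y` is not assumed to stay in `U`: at a time of agreement `y` lies
  -- in `U`, hence also shortly afterwards, where the Lipschitz bound applies.
  refine hclosed.Icc_subset_of_forall_mem_nhdsWithin (by exact h0) ?_ ⟨hb.1, le_rfl⟩
  rintro t ⟨hyx, ht⟩
  have htT : t ∈ Ico 0 T := hsub (Ico_subset_Icc_self ht)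
  have hev : ∀ z : ℝ → E, IsIntegralCurveOn z (fun _ => g) (Ico 0 T) → z t ∈ U →
      ∀ᶠ s in 𝓝[≥] t, z s ∈ U := fun z hz hzU =>
    (hright z hz t htT).continuousWithinAt.eventually (hU.mem_nhds hzU)
  have hytU : y t ∈ U := by rw [show y t = x t from hyx]; exact hxU t htT
  obtain ⟨c, hc, hcs⟩ := mem_nhdsGE_iff_exists_Icc_subset.1
    ((hev x hx (hxU t htT)).and ((hev y hy hytU).and (Ico_mem_nhdsGE htT.2)))
  have hsub' : ∀ s ∈ Icc t c, s ∈ Ico 0 T := fun s hs =>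
    ⟨htT.1.trans hs.1, (hcs hs).2.2.2⟩
  have hE : EqOn y x (Icc t c) := ODE_solution_unique_of_mem_Icc_right (v := fun _ => g)
    (s := fun _ => U) (fun _ _ => hg) (hy.continuousOn.mono hsub')
    (fun s hs => hright y hy s (hsub' s (Ico_subset_Icc_self hs)))
    (fun s hs => (hcs (Ico_subset_Icc_self hs)).2.1)
    (hx.continuousOn.mono hsub')
    (fun s hs => hright x hx s (hsub' s (Ico_subset_Icc_self hs)))
    (fun s hs => (hcs (Ico_subset_Icc_self hs)).1) hyx
  exact mem_of_superset (Icc_mem_nhdsGT hc) hE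

end ODE

/-! ### Exponential stability from a quadratic Lyapunov function. -/

section Lyapunov

variable {E : Type*} [NormedAddCommGroup E] [NormedSpace ℝ E]
  {F : Type*} [NormedAddCommGroup F] [InnerProductSpace ℝ F]

/-- A dissipativity estimate along an integral curve yields exponential decay. -/
theorem IsIntegralCurveOn.norm_le_exp_of_inner_le {h : E → E} {x : ℝ → E}
    (hx : IsIntegralCurveOn x (fun _ => h) (Ici 0)) (S : E →L[ℝ] F) {β : ℝ}
    (hβ : ∀ t, 0 ≤ t → inner ℝ (S (h (x t))) (S (x t)) ≤ -β * ‖S (x t)‖ ^ 2)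
    {t : ℝ} (ht : 0 ≤ t) : ‖S (x t)‖ ≤ Real.exp (-(β * t)) * ‖S (x 0)‖ := by
  have hder : ∀ t ∈ Ici (0 : ℝ), HasDerivWithinAt
      (fun t => Real.exp (2 * β * t) * ‖S (x t)‖ ^ 2)
      (Real.exp (2 * β * t) * (2 * β) * ‖S (x t)‖ ^ 2 +
        Real.exp (2 * β * t) * (2 * inner ℝ (S (x t)) (S (h (x t))))) (Ici 0) t := by
    intro t ht
    have h1 : HasDerivWithinAt (fun t => Real.exp (2 * β * t))
        (Real.exp (2 * β * t) * (2 * β)) (Ici 0) t := by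
      simpa using (((hasDerivAt_id t).const_mul (2 * β)).exp).hasDerivWithinAt (s := Ici 0)
    exact h1.mul ((S.hasFDerivAt.comp_hasDerivWithinAt t (hx t ht)).norm_sq)
  have hanti : AntitoneOn (fun t => Real.exp (2 * β * t) * ‖S (x t)‖ ^ 2) (Ici 0) := by
    refine antitoneOn_of_hasDerivWithinAt_nonpos (convex_Ici 0)
      (fun t ht => (hder t ht).continuousWithinAt)
      (fun t ht => (hder t (interior_subset ht)).mono interior_subset) fun t ht => ?_
    have := hβ t (interior_subset ht)
    rw [real_inner_comm] at this
    have he := Real.exp_pos (2 * β * t)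
    nlinarith
  have h2 := hanti (self_mem_Ici) ht ht
  simp only [mul_zero, Real.exp_zero, one_mul] at h2
  refine le_of_sq_le_sq ?_ (by positivity)
  have h3 : Real.exp (2 * β * t) * (Real.exp (-(β * t))) ^ 2 = 1 := by
    rw [← Real.exp_nat_mul, ← Real.exp_add, ← Real.exp_zero]; congr 1; push_cast; ring
  calc ‖S (x t)‖ ^ 2
      = (Real.exp (-(β * t))) ^ 2 * (Real.exp (2 * β * t) * ‖S (x t)‖ ^ 2) := by
        rw [← mul_assoc, mul_comm (_ ^ 2), h3, one_mul]
    _ ≤ (Real.exp (-(β * t))) ^ 2 * ‖S (x 0)‖ ^ 2 := by gcongr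
    _ = _ := by ring

/-- Lyapunov's indirect method: if the linearization at the equilibrium `0` is strictly dissipative
with respect to some Euclidean norm `x ↦ ‖S x‖`, then `0` is locally exponentially stable. -/
theorem exists_exp_stable_of_dissipative_fderiv [FiniteDimensional ℝ E]
    {g : E → E} (hg : ContDiffAt ℝ 1 g 0) (g0 : g 0 = 0) {J : E →L[ℝ] E} (hJ : HasFDerivAt g J 0)
    (S : E →L[ℝ] F) (hS : Function.Injective S) {α : ℝ} (hα : 0 < α)
    (hdiss : ∀ x, inner ℝ (S (J x)) (S x) ≤ -α * ‖S x‖ ^ 2) :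
    ∃ β > (0 : ℝ), ∃ M > (0 : ℝ), ∃ δ > (0 : ℝ), ∀ x₀ : E, ‖x₀‖ < δ →
      ∃ x : ℝ → E, x 0 = x₀ ∧ IsIntegralCurveOn x (fun _ => g) (Ici 0) ∧
        (∀ (T : ℝ) (y : ℝ → E), 0 < T → y 0 = x₀ →
          IsIntegralCurveOn y (fun _ => g) (Ico 0 T) → EqOn y x (Ico 0 T)) ∧
        ∀ t : ℝ, 0 ≤ t → ‖x t‖ ≤ M * Real.exp (-(β * t)) * ‖x₀‖ := by
  have : CompleteSpace E := FiniteDimensional.complete ℝ E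
  obtain ⟨k, hk0, hk⟩ : ∃ k > 0, AntilipschitzWith k S :=
    (S : E →ₗ[ℝ] F).exists_antilipschitzWith (LinearMap.ker_eq_bot.2 hS)
  have hkS : ∀ x, ‖x‖ ≤ k * ‖S x‖ := fun x => hk.le_mul_norm (map_zero S) x
  -- With this tolerance the nonlinear remainder costs at most half of the decay rate `α`.
  set η : ℝ := α / (2 * (‖S‖ * k + 1)) with hη
  have hη0 : 0 < η := by positivity
  have hηk : ‖S‖ * η * k ≤ α / 2 := by
    rw [hη]
    rw [mul_div_assoc', div_mul_eq_mul_div, div_le_div_iff₀ (by positivity) (by positivity)]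
    nlinarith
  have hlin : ∀ᶠ x in 𝓝 (0 : E), inner ℝ (S (g x)) (S x) ≤ -(α / 2) * ‖S x‖ ^ 2 := by
    have h1 := hJ.isLittleO.def hη0
    filter_upwards [h1] with x hx
    simp only [g0, sub_zero] at hx
    have h2 : inner ℝ (S (g x)) (S x) = inner ℝ (S (J x)) (S x) + inner ℝ (S (g x - J x)) (S x) := by
      rw [map_sub, inner_sub_left]; ring
    have h3 : inner ℝ (S (g x - J x)) (S x) ≤ (‖S‖ * η * k) * ‖S x‖ ^ 2 := by
      calc inner ℝ (S (g x - J x)) (S x) ≤ ‖S (g x - J x)‖ * ‖S x‖ := real_inner_le_norm _ _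
        _ ≤ (‖S‖ * (η * (k * ‖S x‖))) * ‖S x‖ := by
          gcongr
          exact (S.le_opNorm _).trans (by gcongr; exact hx.trans (by gcongr; exact hkS x))
        _ = _ := by ring
    have h4 := hdiss x
    have h5 : (‖S‖ * η * k) * ‖S x‖ ^ 2 ≤ α / 2 * ‖S x‖ ^ 2 := by gcongr
    linarith
  obtain ⟨r, hr, hball⟩ := Metric.eventually_nhds_iff_ball.1
    (hlin.and (hg.eventually (by simp)))
  -- The cutoff makes the field bounded and globally Lipschitz without changing it on the ball of
  -- radius `r / 3`; as `χ ≥ 0`, dissipativity survives with rate `0`.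
  let χ : ContDiffBump (0 : E) := ⟨r / 3, r / 2, by positivity, by linarith⟩
  set h : E → E := fun x => χ x • g x with hh
  have hsmooth : ContDiff ℝ 1 h := by
    rw [contDiff_iff_contDiffAt]
    intro x
    by_cases hx : x ∈ Metric.ball 0 r
    · exact χ.contDiff.contDiffAt.smul (hball x hx).2
    · have hxs : x ∉ tsupport χ := by
        rw [χ.tsupport_eq]
        simp only [Metric.mem_ball, dist_zero_right, not_lt, Metric.mem_closedBall, not_le] at hx ⊢
        change r / 2 < _
        linarith
      have : h =ᶠ[𝓝 x] fun _ => 0 := by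
        filter_upwards [notMem_tsupport_iff_eventuallyEq.1 hxs] with y hy
        simp [hh, hy]
      exact contDiffAt_const.congr_of_eventuallyEq this
  have hcs : HasCompactSupport h := χ.hasCompactSupport.smul_right
  obtain ⟨K, hK⟩ := hsmooth.lipschitzWith_of_hasCompactSupport hcs (by simp)
  obtain ⟨L, hL⟩ := hcs.exists_bound_of_continuous hsmooth.continuous
  have hhg : EqOn h g (Metric.ball 0 (r / 3)) := fun x hx => by
    simp [hh, χ.one_of_mem_closedBall (Metric.ball_subset_closedBall hx)]
  have hnonpos : ∀ x, inner ℝ (S (h x)) (S x) ≤ 0 := by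
    intro x
    simp only [hh, map_smul, real_inner_smul_left]
    by_cases hx : x ∈ Metric.ball 0 r
    · refine mul_nonpos_of_nonneg_of_nonpos χ.nonneg ((hball x hx).1.trans ?_)
      have : 0 ≤ α / 2 * ‖S x‖ ^ 2 := by positivity
      linarith
    · have : χ x = 0 := χ.zero_of_le_dist (by
        simp only [Metric.mem_ball, not_lt] at hx
        change r / 2 ≤ _
        linarith)
      simp [this]
  set M : ℝ := k * ‖S‖ + 1 with hM
  have hM0 : 0 < M := by positivity
  refine ⟨α / 2, by positivity, M, hM0, r / 3 / M, by positivity, fun x₀ hx₀ => ?_⟩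
  obtain ⟨x, hx0, hx⟩ := exists_isIntegralCurveOn_Ici (L := L.toNNReal) hK
    (fun x => (hL x).trans (Real.le_coe_toNNReal L)) x₀
  have hMx₀ : M * ‖x₀‖ < r / 3 := by
    rw [lt_div_iff₀ hM0] at hx₀; linarith
  have hkM : k * ‖S x₀‖ ≤ M * ‖x₀‖ := by
    calc k * ‖S x₀‖ ≤ k * (‖S‖ * ‖x₀‖) := by gcongr; exact S.le_opNorm _
      _ ≤ M * ‖x₀‖ := by rw [hM]; nlinarith [norm_nonneg x₀]
  have hstay : ∀ t, 0 ≤ t → x t ∈ Metric.ball 0 (r / 3) := by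
    intro t ht
    -- Rate `0` suffices to confine the curve to the ball where `h = g`; the rate `α / 2` is
    -- available only after that.
    have h1 := hx.norm_le_exp_of_inner_le S (β := 0) (fun t _ => by simpa using hnonpos (x t)) ht
    simp only [zero_mul, neg_zero, Real.exp_zero, one_mul, hx0] at h1
    rw [mem_ball_zero_iff]
    calc ‖x t‖ ≤ k * ‖S (x t)‖ := hkS _
      _ ≤ k * ‖S x₀‖ := by gcongr
      _ < r / 3 := hkM.trans_lt hMx₀
  have hxg : IsIntegralCurveOn x (fun _ => g) (Ici 0) := fun t ht => by
    have h1 : HasDerivWithinAt x (h (x t)) (Ici 0) t := hx t ht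
    rwa [hhg (hstay t ht)] at h1
  have hlip : LipschitzOnWith K g (Metric.ball 0 (r / 3)) := fun a ha b hb => by
    rw [← hhg ha, ← hhg hb]; exact hK a b
  refine ⟨x, hx0, hxg, fun T y _ hy0 hy => ?_, fun t ht => ?_⟩
  · exact IsIntegralCurveOn.eqOn_Ico_of_lipschitzOnWith Metric.isOpen_ball hlip
      (hxg.mono fun t ht => ht.1) (fun t ht => hstay t ht.1) hy (hy0.trans hx0.symm)
  · have h1 := hxg.norm_le_exp_of_inner_le S (β := α / 2) (fun t ht => (hball (x t)
      (Metric.ball_subset_ball (by linarith) (hstay t ht))).1) ht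
    rw [hx0] at h1
    calc ‖x t‖ ≤ k * ‖S (x t)‖ := hkS _
      _ ≤ k * (Real.exp (-(α / 2 * t)) * ‖S x₀‖) := by gcongr
      _ = Real.exp (-(α / 2 * t)) * (k * ‖S x₀‖) := by ring
      _ ≤ Real.exp (-(α / 2 * t)) * (M * ‖x₀‖) := by gcongr
      _ = _ := by ring

end Lyapunov

/-! ### Adapted inner products for Hurwitz operators. -/

section Hurwitz

/-- An operator on a finite-dimensional complex space all of whose eigenvalues have negative real
part is strictly dissipative with respect to some inner product `(x, y) ↦ ⟪S x, S y⟫`. -/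
theorem Module.End.exists_dissipative_of_forall_hasEigenvalue_re_neg (d : ℕ) :
    ∀ (V : Type) [AddCommGroup V] [Module ℂ V] [FiniteDimensional ℂ V] (T : Module.End ℂ V),
      Module.finrank ℂ V = d → (∀ μ, T.HasEigenvalue μ → μ.re < 0) →
      ∃ (F : Type) (_ : NormedAddCommGroup F) (_ : InnerProductSpace ℂ F) (S : V →ₗ[ℂ] F),
        Function.Injective S ∧ ∃ α > (0 : ℝ),
          ∀ x, (inner ℂ (S (T x)) (S x)).re ≤ -α * ‖S x‖ ^ 2 := by
  induction d using Nat.strong_induction_on with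
  | _ d ih =>
  intro V _ _ _ T hd hT
  rcases subsingleton_or_nontrivial V with hV | hV
  · exact ⟨ℂ, inferInstance, inferInstance, 0, fun x y _ => Subsingleton.elim x y, 1, one_pos,
      fun x => by simp⟩
  -- The kernel of an eigenvector of the dual map is an invariant hyperplane, to which the induction
  -- hypothesis applies.
  obtain ⟨l, hl⟩ := Module.End.exists_eigenvalue (K := ℂ) (V := Module.Dual ℂ V) T.dualMap
  obtain ⟨p, hp⟩ := hl.exists_hasEigenvector
  have hp0 : p ≠ 0 := hp.2
  have hpT : ∀ x, p (T x) = l * p x := fun x => by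
    have := LinearMap.congr_fun hp.apply_eq_smul x
    simpa using this
  obtain ⟨v, hv⟩ : ∃ v, p v = 1 := by
    obtain ⟨w, hw⟩ : ∃ w, p w ≠ 0 := by
      by_contra! hcon
      exact hp0 (LinearMap.ext hcon)
    exact ⟨(p w)⁻¹ • w, by simp [hw]⟩
  have hlre : l.re < 0 := by
    apply hT
    rw [Module.End.hasEigenvalue_iff, Module.End.eigenspace_def, ne_eq, LinearMap.ker_eq_bot,
      ← Algebra.algebraMap_eq_smul_one]
    -- `p` vanishes on the range of `T - l`, so `T - l` is not onto and, in finite dimension, not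
    -- injective.
    intro hinj
    obtain ⟨w, hw⟩ := LinearMap.injective_iff_surjective.1 hinj v
    have : p ((T - algebraMap ℂ (Module.End ℂ V) l) w) = 0 := by
      simp [Module.algebraMap_end_apply, hpT]
    rw [hw, hv] at this
    exact one_ne_zero this
  set W := LinearMap.ker p with hW
  have hTW : ∀ x ∈ W, T x ∈ W := fun x hx => by
    rw [hW, LinearMap.mem_ker] at hx ⊢; rw [hpT, hx, mul_zero]
  have hWd : Module.finrank ℂ W < d := by
    rw [← hd]
    apply Submodule.finrank_lt
    intro htop
    exact hp0 (LinearMap.ker_eq_top.1 htop)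
  obtain ⟨F, iF, iF', S, hS, β, hβ, hdiss⟩ := ih _ hWd W (T.restrict hTW) rfl fun μ hμ => by
    apply hT
    obtain ⟨w, hw⟩ := hμ.exists_hasEigenvector
    refine Module.End.hasEigenvalue_of_hasEigenvector (x := (w : V)) ⟨?_, ?_⟩
    · rw [Module.End.mem_eigenspace_iff]
      simpa using congrArg Subtype.val hw.apply_eq_smul
    · simpa using hw.2
  -- Projection onto `W` along `v`; in the splitting `W ⊕ ℂ v` the operator is block triangular.
  let P : V →ₗ[ℂ] W := (LinearMap.id - p.smulRight v).codRestrict W fun x => by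
    simp [hW, hv]
  have hPval : ∀ x, (P x : V) = x - p x • v := fun x => rfl
  have hPT : ∀ x, P (T x) = T.restrict hTW (P x) + p x • P (T v) := by
    intro x
    apply Subtype.ext
    simp only [Submodule.coe_add, Submodule.coe_smul, LinearMap.coe_restrict_apply, hPval, hpT,
      map_sub, map_smul, hv]
    module
  set k : ℝ := ‖S (P (T v))‖ with hk
  set α : ℝ := min β (-l.re) / 2 with hα
  have hmin : 0 < min β (-l.re) := lt_min hβ (by linarith)
  have hα0 : 0 < α := by positivity
  have hα1 : 2 * α ≤ β := by rw [hα]; linarith [min_le_left β (-l.re)]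
  have hα2 : 2 * α ≤ -l.re := by rw [hα]; linarith [min_le_right β (-l.re)]
  -- The weight of `p` in the new norm. Half of the diagonal dissipation, `α (a² + c² q²) ≥ 2 α c a
  -- q`, absorbs the off-diagonal term `k a q` once `k ≤ 2 α c`.
  set c : ℝ := k / α + 1 with hc
  have hc0 : 0 < c := by positivity
  have hck : k ≤ 2 * α * c := by
    have : α * c = k + α := by rw [hc]; field_simp
    have : 0 ≤ k := norm_nonneg _
    linarith
  let S' : V →ₗ[ℂ] WithLp 2 (F × ℂ) :=
    (WithLp.linearEquiv 2 ℂ (F × ℂ)).symm.toLinearMap ∘ₗ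
      ((S ∘ₗ P).prod ((c : ℂ) • p))
  have hS'1 : ∀ x, (S' x).fst = S (P x) := fun x => rfl
  have hS'2 : ∀ x, (S' x).snd = c * p x := fun x => rfl
  refine ⟨WithLp 2 (F × ℂ), inferInstance, inferInstance, S', ?_, α, hα0, fun x => ?_⟩
  · rw [← LinearMap.ker_eq_bot, LinearMap.ker_eq_bot']
    intro x hx
    have h1 : S (P x) = 0 := by rw [← hS'1, hx]; rfl
    have h2 : (c : ℂ) * p x = 0 := by rw [← hS'2, hx]; rfl
    have h3 : p x = 0 := by
      simpa [hc0.ne'] using h2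
    have h4 : P x = 0 := hS (by rw [h1, map_zero])
    have h5 := congrArg Subtype.val h4
    simpa [hPval, h3] using h5
  · have hnorm : ‖S' x‖ ^ 2 = ‖S (P x)‖ ^ 2 + c ^ 2 * ‖p x‖ ^ 2 := by
      rw [WithLp.prod_norm_sq_eq_of_L2, hS'1, hS'2, norm_mul, mul_pow]
      simp
    have hd := hdiss (P x)
    have hcross : (inner ℂ (p x • S (P (T v))) (S (P x))).re ≤ ‖p x‖ * k * ‖S (P x)‖ := by
      refine (Complex.re_le_norm _).trans ((norm_inner_le_norm _ _).trans ?_)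
      rw [norm_smul]
    have hdiag : (inner ℂ ((c : ℂ) * (l * p x)) ((c : ℂ) * p x)).re =
        c ^ 2 * l.re * ‖p x‖ ^ 2 := by
      have : inner ℂ ((c : ℂ) * (l * p x)) ((c : ℂ) * p x) =
          (c : ℂ) ^ 2 * (starRingEnd ℂ l) * ((‖p x‖ ^ 2 : ℝ) : ℂ) := by
        rw [RCLike.inner_apply]
        simp only [map_mul, Complex.conj_ofReal]
        push_cast
        rw [← Complex.mul_conj']
        ring
      rw [this]
      simp [← Complex.ofReal_pow]
    have hinner : inner ℂ (S' (T x)) (S' x) = inner ℂ (S (P (T x))) (S (P x)) +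
        inner ℂ ((c : ℂ) * p (T x)) ((c : ℂ) * p x) := rfl
    rw [hinner, hPT, hpT, map_add, map_smul,
      inner_add_left, Complex.add_re, Complex.add_re, hdiag, hnorm]
    set a := ‖S (P x)‖
    set q := ‖p x‖
    have ha : 0 ≤ a := norm_nonneg _
    have hq : 0 ≤ q := norm_nonneg _
    have h1 : q * k * a ≤ 2 * α * c * (q * a) := by
      have := mul_le_mul_of_nonneg_right hck (mul_nonneg hq ha); linarith
    have h2 : 2 * α * c * (q * a) ≤ α * (a ^ 2 + c ^ 2 * q ^ 2) := by
      nlinarith [mul_nonneg hα0.le (sq_nonneg (a - c * q))]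
    have h3 : 2 * α * a ^ 2 ≤ β * a ^ 2 := by gcongr
    have h4 : 2 * α * (c ^ 2 * q ^ 2) ≤ -l.re * (c ^ 2 * q ^ 2) := by gcongr
    linarith

end Hurwitz

/-! ### Moving one eigenvalue by a rank-one perturbation. -/

section PoleShifting

open Matrix Polynomial

variable {n m : Type*} [Fintype n] [DecidableEq n] [Fintype m]

/-- A rank-one perturbation along a left eigenvector moves the corresponding root of the
characteristic polynomial and no other. -/
theorem Matrix.charpoly_add_vecMulVec_of_vecMul_eq {A : Matrix n n ℝ} {p : n → ℝ} {l : ℝ}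
    (hp : p ᵥ* A = l • p) (hn : Nonempty n) (b : n → ℝ) :
    (X - C l) * (A + vecMulVec b p).charpoly = (X - C (l + b ⬝ᵥ p)) * A.charpoly := by
  have hmat : ∀ z : ℝ, (z - l) • (scalar n z - (A + vecMulVec b p)) =
      (scalar n (z - l) - vecMulVec b p) * (scalar n z - A) := by
    intro z
    have h1 : vecMulVec b p * A = l • vecMulVec b p := by
      rw [vecMulVec_mul, hp, vecMulVec_smul]
    have h2 : vecMulVec b p * scalar n z = z • vecMulVec b p := by
      simp [← smul_one_eq_diagonal]
    rw [sub_mul, mul_sub, mul_sub, h1, h2]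
    simp only [scalar_apply, ← smul_one_eq_diagonal, smul_mul_assoc, one_mul]
    simp only [sub_smul, smul_sub, smul_add]
    abel
  have hcard : Fintype.card n = (Fintype.card n - 1) + 1 :=
    (Nat.sub_add_cancel Fintype.card_pos).symm
  -- In the determinant of `hmat`, the scalar contributes `(z - l) ^ card n` and the rank-one factor
  -- `(z - l) ^ (card n - 1) * (z - l - b ⬝ᵥ p)`; the common power cancels as polynomials.
  have hcomm : (X - C l) ^ (Fintype.card n - 1) * ((X - C l) * (A + vecMulVec b p).charpoly) =
      (X - C l) ^ (Fintype.card n - 1) * ((X - C (l + b ⬝ᵥ p)) * A.charpoly) := by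
    refine Polynomial.funext fun z => ?_
    have h := congrArg det (hmat z)
    rw [det_smul, det_mul, ← eval_charpoly, ← eval_charpoly, ← eval_charpoly,
      charpoly_vecMulVec] at h
    rw [hcard] at h
    simp only [eval_mul, eval_pow, eval_sub, eval_X, eval_C, eval_smul, smul_eq_mul,
      Nat.add_sub_cancel] at h ⊢
    rw [pow_succ] at h
    linear_combination h
  exact mul_left_cancel₀ (pow_ne_zero _ (X_sub_C_ne_zero l)) hcomm

end PoleShifting

/-! ### Stabilizing the linearization, by induction on the number of unstable roots with
multiplicity. -/

section Stabilization

open Matrix Polynomial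

variable {n m : Type*} [Fintype n] [DecidableEq n] [Fintype m]

/-- If the eigenvalues of `A` in the closed right half-plane are real and satisfy Hautus' condition,
then some feedback matrix moves the whole spectrum into the open left half-plane. -/
theorem Matrix.exists_feedback_of_hautus (B : Matrix n m ℝ) (c : ℕ) :
    ∀ A : Matrix n n ℝ,
      (A.charpoly.map Complex.ofRealHom).roots.countP (fun μ => 0 ≤ μ.re) = c →
      (∀ μ ∈ (A.charpoly.map Complex.ofRealHom).roots, 0 ≤ μ.re → μ.im = 0) →
      (∀ l : ℝ, 0 ≤ l → ∀ p : n → ℝ, p ≠ 0 → p ᵥ* A = l • p → p ᵥ* B ≠ 0) →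
      ∃ K : Matrix m n ℝ, ∀ μ ∈ ((A + B * K).charpoly.map Complex.ofRealHom).roots, μ.re < 0 := by
  induction c with
  | zero =>
    intro A hA _ _
    rw [Multiset.countP_eq_zero] at hA
    exact ⟨0, fun μ hμ => by simpa using hA μ (by simpa using hμ)⟩
  | succ c ih =>
    intro A hA hreal hB
    obtain ⟨μ, hμ, hμre⟩ := Multiset.countP_pos.1 ((Nat.succ_pos c).trans_eq hA.symm)
    set l := μ.re with hl
    have hμl : μ = (l : ℂ) := Complex.ext rfl (by simpa using hreal μ hμ hμre)
    obtain ⟨p, hp0, hp⟩ : ∃ p : n → ℝ, p ≠ 0 ∧ p ᵥ* A = l • p := by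
      have h1 : A.charpoly.eval l = 0 := by
        have h2 := isRoot_of_mem_roots hμ
        rw [hμl, IsRoot.def, show (l : ℂ) = Complex.ofRealHom l from rfl, eval_map,
          eval₂_at_apply] at h2
        simpa using h2
      rw [eval_charpoly, ← exists_vecMul_eq_zero_iff] at h1
      obtain ⟨p, hp0, hp⟩ := h1
      refine ⟨p, hp0, ?_⟩
      rw [vecMul_sub, sub_eq_zero] at hp
      rw [← hp, scalar_apply, ← smul_one_eq_diagonal, vecMul_smul, vecMul_one]
    have hn : Nonempty n := by
      by_contra h
      rw [not_nonempty_iff] at h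
      exact hp0 (Subsingleton.elim _ _)
    set w := p ᵥ* B with hw
    have hw0 : w ⬝ᵥ w ≠ 0 := by
      rw [ne_eq, dotProduct_self_eq_zero]; exact hB l hμre p hp0 hp
    -- Scaled so that `l + (B *ᵥ v) ⬝ᵥ p = -1`.
    set v : m → ℝ := (-(l + 1) / (w ⬝ᵥ w)) • w with hv
    have hbp : (B *ᵥ v) ⬝ᵥ p = -(l + 1) := by
      rw [dotProduct_comm, dotProduct_mulVec, ← hw, hv, dotProduct_smul, smul_eq_mul]
      field_simp
    have hroots : (l : ℂ) ::ₘ ((A + B * vecMulVec v p).charpoly.map Complex.ofRealHom).roots =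
        -1 ::ₘ (A.charpoly.map Complex.ofRealHom).roots := by
      have h := charpoly_add_vecMulVec_of_vecMul_eq hp hn (B *ᵥ v)
      rw [hbp, ← mul_vecMulVec] at h
      have h' := congrArg (fun q => (q.map Complex.ofRealHom).roots) h
      have hmon : ∀ M : Matrix n n ℝ, M.charpoly.map Complex.ofRealHom ≠ 0 := fun M =>
        (M.charpoly_monic.map _).ne_zero
      simp only [Polynomial.map_mul, Polynomial.map_sub, map_X, map_C] at h'
      rw [roots_mul (mul_ne_zero (X_sub_C_ne_zero _) (hmon _)),
        roots_mul (mul_ne_zero (X_sub_C_ne_zero _) (hmon _)), roots_X_sub_C, roots_X_sub_C] at h'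
      simpa using h'
    have hmem : ∀ ν ∈ ((A + B * vecMulVec v p).charpoly.map Complex.ofRealHom).roots,
        ν = -1 ∨ ν ∈ (A.charpoly.map Complex.ofRealHom).roots := fun ν hν => by
      rw [← Multiset.mem_cons, ← hroots]; exact Multiset.mem_cons_of_mem hν
    obtain ⟨K, hK⟩ := ih (A + B * vecMulVec v p) (by
        have h := congrArg (Multiset.countP fun μ : ℂ => 0 ≤ μ.re) hroots
        rw [Multiset.countP_cons_of_pos _ (by simpa using hμre),
          Multiset.countP_cons_of_neg _ (by norm_num), hA] at h
        omega)
      (fun ν hν hre => by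
        rcases hmem ν hν with rfl | h
        · norm_num at hre
        · exact hreal ν h hre)
      -- Hautus' condition is invariant under feedback: if `q ᵥ* B = 0`, the feedback term does not
      -- act on `q`.
      (fun l' hl' q hq0 hq hqB => by
        refine hB l' hl' q hq0 ?_ hqB
        rwa [vecMul_add, ← vecMul_vecMul, hqB, zero_vecMul, add_zero] at hq)
    refine ⟨vecMulVec v p + K, ?_⟩
    rwa [Matrix.mul_add, ← add_assoc]

end Stabilization

/-! ### Surjectivity of an exponentially stable linearization. -/

section ExpStable

variable {E : Type*} [NormedAddCommGroup E] [InnerProductSpace ℝ E]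

/-- The linearization at a locally exponentially stable equilibrium is surjective. -/
theorem range_eq_top_of_exp_stable [FiniteDimensional ℝ E]
    {g : E → E} (g0 : g 0 = 0) {J : E →L[ℝ] E} (hJ : HasFDerivAt g J 0)
    {α M δ : ℝ} (hα : 0 < α) (hM : 0 < M) (hδ : 0 < δ)
    (hstab : ∀ x₀ : E, ‖x₀‖ < δ → ∃ x : ℝ → E, x 0 = x₀ ∧
      IsIntegralCurveOn x (fun _ => g) (Ici 0) ∧
        ∀ t : ℝ, 0 ≤ t → ‖x t‖ ≤ M * Real.exp (-(α * t)) * ‖x₀‖) :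
    J.range = ⊤ := by
  by_contra hne
  obtain ⟨w, hw, hw0⟩ := Submodule.exists_mem_ne_zero_of_ne_bot
    (mt Submodule.orthogonal_eq_bot_iff.1 hne)
  have hwJ : ∀ x, inner ℝ w (J x) = 0 := fun x => by
    rw [real_inner_comm]; exact hw _ ⟨x, rfl⟩
  have hwn : 0 < ‖w‖ := norm_pos_iff.2 hw0
  obtain ⟨T, hT, hT0⟩ : ∃ T, M * Real.exp (-(α * T)) ≤ 1 / 2 ∧ 0 < T := by
    have h1 : Tendsto (fun T => M * Real.exp (-(α * T))) atTop (𝓝 (M * 0)) :=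
      (Real.tendsto_exp_neg_atTop_nhds_zero.comp (tendsto_id.const_mul_atTop hα)).const_mul M
    rw [mul_zero] at h1
    exact ((h1.eventually (ge_mem_nhds (by norm_num : (0 : ℝ) < 1 / 2))).and
      (eventually_gt_atTop 0)).exists
  -- By time `T` the remainder changes `⟪w, x⟫` by at most a quarter of its initial value, whereas
  -- the decay would remove at least half of it.
  have hη : 0 < 1 / (4 * M * T) := by positivity
  obtain ⟨ρ, hρ, hball⟩ := Metric.eventually_nhds_iff_ball.1 (hJ.isLittleO.def hη)
  simp only [g0, sub_zero, mem_ball_zero_iff] at hball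
  -- The start lies in the stability ball, and the whole orbit stays where the linearization
  -- estimate holds.
  set ε := min (δ / 2) (ρ / (2 * M)) / ‖w‖ with hε
  have hε0 : 0 < ε := by positivity
  have hnorm : ‖ε • w‖ = ε * ‖w‖ := by rw [norm_smul, Real.norm_of_nonneg hε0.le]
  have hεw : ε * ‖w‖ = min (δ / 2) (ρ / (2 * M)) := by rw [hε]; field_simp
  have h1 : ε * ‖w‖ < δ := by
    rw [hεw]; exact (min_le_left _ _).trans_lt (by linarith)
  have h2 : M * (ε * ‖w‖) < ρ := by
    calc M * (ε * ‖w‖) ≤ M * (ρ / (2 * M)) := by rw [hεw]; gcongr; exact min_le_right _ _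
      _ = ρ / 2 := by field_simp
      _ < ρ := by linarith
  obtain ⟨x, hx0, hx, hdecay⟩ := hstab (ε • w) (by rwa [hnorm])
  rw [hnorm] at hdecay
  have hbd : ∀ t, 0 ≤ t → ‖x t‖ ≤ M * (ε * ‖w‖) := fun t ht => by
    refine (hdecay t ht).trans ?_
    have : Real.exp (-(α * t)) ≤ 1 := Real.exp_le_one_iff.2 (by nlinarith)
    calc M * Real.exp (-(α * t)) * (ε * ‖w‖) ≤ M * 1 * (ε * ‖w‖) := by gcongr
      _ = _ := by ring
  have hmv := (convex_Ici (0 : ℝ)).norm_image_sub_le_of_norm_hasDerivWithin_le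
    (f := fun t => inner ℝ w (x t)) (f' := fun t => inner ℝ w (g (x t)))
    (C := ‖w‖ * (1 / (4 * M * T) * (M * (ε * ‖w‖)))) (x := 0) (y := T)
    (fun t ht => by
      exact (innerSL ℝ w).hasFDerivAt.comp_hasDerivWithinAt t (hx t ht))
    (fun t ht => by
      have h3 : inner ℝ w (g (x t)) = inner ℝ w (g (x t) - J (x t)) := by
        rw [inner_sub_right, hwJ, sub_zero]
      rw [h3]
      refine (norm_inner_le_norm _ _).trans ?_
      gcongr
      exact (hball _ ((hbd t ht).trans_lt h2)).trans (by gcongr; exact hbd t ht))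
    self_mem_Ici hT0.le
  have h4 : inner ℝ w (x T) ≤ 1 / 2 * (ε * ‖w‖ ^ 2) := by
    calc inner ℝ w (x T) ≤ ‖w‖ * ‖x T‖ := real_inner_le_norm _ _
      _ ≤ ‖w‖ * (1 / 2 * (ε * ‖w‖)) := by
        gcongr; exact (hdecay T hT0.le).trans (by gcongr)
      _ = _ := by ring
  have h5 : inner ℝ w (x 0) = ε * ‖w‖ ^ 2 := by
    rw [hx0, inner_smul_right, real_inner_self_eq_norm_sq]
  have h6 : ‖w‖ * (1 / (4 * M * T) * (M * (ε * ‖w‖))) * ‖T - 0‖ = 1 / 4 * (ε * ‖w‖ ^ 2) := by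
    rw [sub_zero, Real.norm_of_nonneg hT0.le]; field_simp
  rw [h6, Real.norm_eq_abs, h5] at hmv
  have h7 := (abs_le.1 hmv).1
  have h8 : 0 < ε * ‖w‖ ^ 2 := by positivity
  linarith

end ExpStable

/-! ### Surjective strict derivative implies linear openness. -/

section LinearOpenness

variable {Z Y : Type*} [NormedAddCommGroup Z] [NormedSpace ℝ Z] [CompleteSpace Z]
  [NormedAddCommGroup Y] [NormedSpace ℝ Y] [CompleteSpace Y]

/-- The Lyusternik–Graves theorem. -/
theorem HasStrictFDerivAt.linearlyOpen {f : Z → Y} {D : Z →L[ℝ] Y} {z₀ : Z}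
    (hf : HasStrictFDerivAt f D z₀) (hD : D.range = ⊤) : LinearlyOpen f z₀ := by
  let R := D.nonlinearRightInverseOfSurjective hD
  have hR : 0 < R.nnnorm := D.nonlinearRightInverseOfSurjective_nnnorm_pos hD
  -- Half of `R.nnnorm⁻¹` is spent on the approximation error; the other half, again `c`, is the
  -- modulus.
  set c : ℝ≥0 := R.nnnorm⁻¹ / 2 with hc
  have hc0 : 0 < c := by positivity
  obtain ⟨s, hs, happ⟩ := hf.approximates_deriv_on_nhds (Or.inr hc0)
  have hκ : (R.nnnorm : ℝ)⁻¹ - c = c := by rw [hc]; push_cast; ring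
  refine ⟨c, by exact_mod_cast hc0, s, hs, fun z _ r hr hzr => ?_⟩
  have := happ.surjOn_closedBall_of_nonlinearRightInverse R hr.le hzr
  rwa [hκ] at this

end LinearOpenness

/-! ### Linearization of the control system, Hautus' condition and feedback. -/

section ControlSystem

open Matrix

variable {n m : ℕ}

theorem EuclideanSpace.clm_apply_eq_mulVec {k : ℕ}
    (L : EuclideanSpace ℝ (Fin k) →L[ℝ] EuclideanSpace ℝ (Fin n)) (x : EuclideanSpace ℝ (Fin k)) :
    (L x).ofLp = (Matrix.of fun i j => L (EuclideanSpace.single j 1) i) *ᵥ x.ofLp := by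
  ext i
  conv_lhs => rw [← (EuclideanSpace.basisFun (Fin k) ℝ).sum_repr x]
  simp [Matrix.mulVec, dotProduct, mul_comm]

/-- The derivative of `f` at the origin is `(x, u) ↦ A x + B u`. -/
theorem ofLp_fderiv_zero_apply {f : StateControl n m → EuclideanSpace ℝ (Fin n)}
    {D : StateControl n m →L[ℝ] EuclideanSpace ℝ (Fin n)} (hf : HasFDerivAt f D 0)
    (z : StateControl n m) :
    (D z).ofLp = stateJacobian f *ᵥ z.fst.ofLp + controlJacobian f *ᵥ z.snd.ofLp := by
  let e := (WithLp.prodContinuousLinearEquiv 2 ℝ (EuclideanSpace ℝ (Fin n))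
    (EuclideanSpace ℝ (Fin m))).symm.toContinuousLinearMap
  have h1 : HasFDerivAt (fun x : EuclideanSpace ℝ (Fin n) => f (WithLp.toLp 2 (x, 0)))
      (D ∘L (e ∘L ContinuousLinearMap.inl ℝ _ _)) 0 :=
    HasFDerivAt.comp (g := f) 0 (by exact hf)
      (e ∘L ContinuousLinearMap.inl ℝ _ _).hasFDerivAt
  have h2 : HasFDerivAt (fun u : EuclideanSpace ℝ (Fin m) => f (WithLp.toLp 2 (0, u)))
      (D ∘L (e ∘L ContinuousLinearMap.inr ℝ _ _)) 0 :=
    HasFDerivAt.comp (g := f) 0 (by exact hf)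
      (e ∘L ContinuousLinearMap.inr ℝ _ _).hasFDerivAt
  have hz : D z = (D ∘L (e ∘L ContinuousLinearMap.inl ℝ _ _)) z.fst +
      (D ∘L (e ∘L ContinuousLinearMap.inr ℝ _ _)) z.snd := by
    simp only [ContinuousLinearMap.comp_apply, ← map_add]
    congr 1
    simp only [ContinuousLinearMap.inl_apply, ContinuousLinearMap.inr_apply, Prod.mk_add_mk,
      add_zero, zero_add]
    rfl
  rw [hz, WithLp.ofLp_add, EuclideanSpace.clm_apply_eq_mulVec, EuclideanSpace.clm_apply_eq_mulVec,
    stateJacobian, controlJacobian, h1.fderiv, h2.fderiv]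

/-- The linearization of the closed-loop system. -/
theorem hasFDerivAt_closedLoop {f : StateControl n m → EuclideanSpace ℝ (Fin n)}
    {D : StateControl n m →L[ℝ] EuclideanSpace ℝ (Fin n)} (hf : HasFDerivAt f D 0)
    {u : EuclideanSpace ℝ (Fin n) → EuclideanSpace ℝ (Fin m)} (u0 : u 0 = 0)
    {u' : EuclideanSpace ℝ (Fin n) →L[ℝ] EuclideanSpace ℝ (Fin m)} (hu : HasFDerivAt u u' 0) :
    HasFDerivAt (closedLoop f u)
      (D ∘L ((WithLp.prodContinuousLinearEquiv 2 ℝ _ _).symm.toContinuousLinearMap ∘L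
        (ContinuousLinearMap.id ℝ _).prod u')) 0 := by
  have h1 := (WithLp.prodContinuousLinearEquiv 2 ℝ (EuclideanSpace ℝ (Fin n))
    (EuclideanSpace ℝ (Fin m))).symm.toContinuousLinearMap.hasFDerivAt.comp
      (0 : EuclideanSpace ℝ (Fin n)) ((hasFDerivAt_id (𝕜 := ℝ) _).prodMk hu)
  refine HasFDerivAt.comp (g := f) 0 ?_ h1
  have : WithLp.toLp 2 ((0 : EuclideanSpace ℝ (Fin n)), u 0) = 0 := by rw [u0]; rfl
  simpa [this] using hf

/-- Hautus' condition holds at real eigenvalues below a modulus of linear openness. -/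
theorem LinearlyOpenWith.vecMul_controlJacobian_ne_zero
    {f : StateControl n m → EuclideanSpace ℝ (Fin n)} (hfd : DifferentiableAt ℝ f 0)
    (hf0 : f 0 = 0) {κ : ℝ} (hκ : LinearlyOpenWith f 0 κ) {l : ℝ} (hl : 0 ≤ l) (hlκ : l < κ)
    {p : Fin n → ℝ} (hp0 : p ≠ 0) (hp : p ᵥ* stateJacobian f = l • p) :
    p ᵥ* controlJacobian f ≠ 0 := by
  intro hpB
  obtain ⟨hκ0, U, hU, hopen⟩ := hκ
  set D := fderiv ℝ f 0
  have hD : HasFDerivAt f D 0 := hfd.hasFDerivAt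
  set P : EuclideanSpace ℝ (Fin n) := WithLp.toLp 2 p with hP
  have hPn : 0 < ‖P‖ := norm_pos_iff.2 fun h => hp0 (congrArg WithLp.ofLp h)
  have hPD : ∀ z, inner ℝ P (D z) = l * inner ℝ P z.fst := by
    intro z
    rw [EuclideanSpace.inner_eq_star_dotProduct, EuclideanSpace.inner_eq_star_dotProduct,
      ofLp_fderiv_zero_apply hD]
    simp only [star_trivial]
    rw [dotProduct_comm, dotProduct_add, dotProduct_mulVec, dotProduct_mulVec, hP]
    simp only [hp, hpB, zero_dotProduct, add_zero, smul_dotProduct, smul_eq_mul]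
    rw [dotProduct_comm]
  have hη : 0 < (κ - l) / 2 := by linarith
  have hev := (hD.isLittleO.def hη).and hU
  obtain ⟨r, hr, hball⟩ := Metric.nhds_basis_closedBall.eventually_iff.1 hev
  simp only [hf0, sub_zero] at hball
  -- The point of the ball farthest in the direction `P`: reaching it requires `κ r ‖P‖`, but the
  -- image only attains `(κ + l) / 2 * r ‖P‖`.
  have hy : (κ * r / ‖P‖) • P ∈ Metric.closedBall (f 0) (κ * r) := by
    rw [hf0, mem_closedBall_zero_iff, norm_smul, Real.norm_of_nonneg (by positivity)]
    field_simp; rfl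
  obtain ⟨z, hz, hfz⟩ := hopen 0 (mem_of_mem_nhds hU) r hr (fun z hz => (hball hz).2) hy
  have hzr : ‖z‖ ≤ r := mem_closedBall_zero_iff.1 hz
  have h1 : inner ℝ P (f z) = κ * r * ‖P‖ := by
    rw [hfz, inner_smul_right, real_inner_self_eq_norm_sq]; field_simp
  have h2 : inner ℝ P (f z) ≤ ‖P‖ * ((κ - l) / 2 * r) + l * (‖P‖ * r) := by
    have h3 : inner ℝ P (f z) = inner ℝ P (f z - D z) + l * inner ℝ P z.fst := by
      rw [← hPD, inner_sub_right]; ring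
    rw [h3]
    gcongr
    · refine (real_inner_le_norm _ _).trans ?_
      gcongr
      exact (hball hz).1.trans (by gcongr)
    · refine (real_inner_le_norm _ _).trans ?_
      gcongr
      exact (WithLp.norm_fst_le _ z).trans hzr
  rw [h1] at h2
  have h3 : 0 < r * ‖P‖ := by positivity
  nlinarith

/-- A linear feedback that makes the linearized closed loop Hurwitz stabilizes the system. -/
theorem locallyExpStabilizes_of_forall_roots_re_neg
    {f : StateControl n m → EuclideanSpace ℝ (Fin n)} (hf : ContDiffAt ℝ 1 f 0) (hf0 : f 0 = 0)
    (K : Matrix (Fin m) (Fin n) ℝ)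
    (hK : ∀ μ ∈ ((stateJacobian f + controlJacobian f * K).charpoly.map
      Complex.ofRealHom).roots, μ.re < 0) :
    LocallyExpStabilizes f (Matrix.toEuclideanLin K) := by
  set u := (Matrix.toEuclideanLin K).toContinuousLinearMap with hu
  have hD : HasFDerivAt f (fderiv ℝ f 0) 0 := (hf.differentiableAt (by simp)).hasFDerivAt
  set N := stateJacobian f + controlJacobian f * K with hN
  have hroot : ∀ μ : ℂ,
      Module.End.HasEigenvalue (Matrix.toLin' (N.map Complex.ofRealHom)) μ → μ.re < 0 := by
    intro μ hμ
    apply hK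
    rw [Module.End.hasEigenvalue_iff_isRoot_charpoly, Matrix.charpoly_toLin',
      Matrix.charpoly_map] at hμ
    exact (Polynomial.mem_roots (N.charpoly_monic.map _).ne_zero).2 hμ
  obtain ⟨F, _, _, S, hS, α, hα, hdiss⟩ :=
    Module.End.exists_dissipative_of_forall_hasEigenvalue_re_neg _ (Fin n → ℂ)
      (Matrix.toLin' (N.map Complex.ofRealHom)) rfl hroot
  -- The complex norm descends to `ℝⁿ` by restriction: the real inner product is the real part of
  -- the complex one, and `c` embeds `ℝⁿ` in `ℂⁿ`.
  let : InnerProductSpace ℝ F := InnerProductSpace.rclikeToReal ℂ F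
  let c : EuclideanSpace ℝ (Fin n) →ₗ[ℝ] (Fin n → ℂ) :=
    { toFun := fun x i => (x i : ℂ)
      map_add' := fun x y => by ext i; simp
      map_smul' := fun a x => by ext i; simp }
  have hc : Function.Injective c := fun x y h => by
    ext i; exact Complex.ofReal_injective (congrFun h i)
  let S' : EuclideanSpace ℝ (Fin n) →L[ℝ] F :=
    ((S.restrictScalars ℝ) ∘ₗ c).toContinuousLinearMap
  have hJ := hasFDerivAt_closedLoop hD (map_zero u) u.hasFDerivAt
  set J := fderiv ℝ f 0 ∘L ((WithLp.prodContinuousLinearEquiv 2 ℝ _ _).symm.toContinuousLinearMap ∘L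
        (ContinuousLinearMap.id ℝ _).prod u) with hJdef
  have hJN : ∀ x, (J x).ofLp = N *ᵥ x.ofLp := by
    intro x
    have h1 : J x = fderiv ℝ f 0 (WithLp.toLp 2 (x, u x)) := rfl
    have h2 : (u x).ofLp = K *ᵥ x.ofLp := rfl
    rw [h1, ofLp_fderiv_zero_apply hD, hN, add_mulVec, ← mulVec_mulVec, ← h2]
    rfl
  have hcJ : ∀ x, c (J x) = Matrix.toLin' (N.map Complex.ofRealHom) (c x) := by
    intro x
    ext i
    have : c (J x) i = (((J x).ofLp i : ℝ) : ℂ) := rfl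
    rw [this, hJN, Matrix.toLin'_apply]
    simp [Matrix.mulVec, dotProduct, c]
  have hg : ContDiffAt ℝ 1 (closedLoop f u) 0 := by
    have h0 : WithLp.toLp 2 ((0 : EuclideanSpace ℝ (Fin n)), u 0) = 0 := by rw [map_zero]; rfl
    have h1 : ContDiff ℝ 1 fun x : EuclideanSpace ℝ (Fin n) => WithLp.toLp 2 (x, u x) :=
      (WithLp.prodContinuousLinearEquiv 2 ℝ (EuclideanSpace ℝ (Fin n))
        (EuclideanSpace ℝ (Fin m))).symm.contDiff.comp (contDiff_id.prodMk u.contDiff)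
    exact ContDiffAt.comp (g := f) 0 (by rw [h0]; exact hf) h1.contDiffAt
  have hg0 : closedLoop f u 0 = 0 := by
    have h0 : WithLp.toLp 2 ((0 : EuclideanSpace ℝ (Fin n)), u 0) = 0 := by rw [map_zero]; rfl
    rw [closedLoop, h0, hf0]
  have hS' : Function.Injective S' := hS.comp hc
  have hdiss' : ∀ x, inner ℝ (S' (J x)) (S' x) ≤ -α * ‖S' x‖ ^ 2 := fun x => by
    have h := hdiss (c x)
    rw [← hcJ] at h
    exact h
  exact ⟨map_zero u, exists_exp_stable_of_dissipative_fderiv hg hg0 hJ S' hS' hα hdiss'⟩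

/-- Stabilizability by a differentiable feedback forces a surjective derivative at the origin. -/
theorem LocallyExpStabilizes.range_fderiv_eq_top
    {f : StateControl n m → EuclideanSpace ℝ (Fin n)}
    {D : StateControl n m →L[ℝ] EuclideanSpace ℝ (Fin n)} (hf : HasFDerivAt f D 0)
    (hf0 : f 0 = 0) {u : EuclideanSpace ℝ (Fin n) → EuclideanSpace ℝ (Fin m)}
    (hu : DifferentiableAt ℝ u 0) (hstab : LocallyExpStabilizes f u) : D.range = ⊤ := by
  obtain ⟨u0, α, hα, M, hM, δ, hδ, h⟩ := hstab
  have h0 : WithLp.toLp 2 ((0 : EuclideanSpace ℝ (Fin n)), u 0) = 0 := by rw [u0]; rfl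
  have hsurj := range_eq_top_of_exp_stable (g := closedLoop f u) (by rw [closedLoop, h0, hf0])
    (hasFDerivAt_closedLoop hf u0 hu.hasFDerivAt) hα hM hδ fun x₀ hx₀ => by
      obtain ⟨x, hx0, hx, -, hdec⟩ := h x₀ hx₀
      exact ⟨x, hx0, hx, hdec⟩
  rw [eq_top_iff, ← hsurj]
  exact LinearMap.range_comp_le_range _ _

end ControlSystem

/-! ### Assembly of the two implications. -/

theorem theorem3p2 (n m : ℕ) (f : StateControl n m → EuclideanSpace ℝ (Fin n))
    (hf : ∃ W ∈ 𝓝 (0 : StateControl n m), ContDiffOn ℝ 1 f W)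
    (hf0 : f 0 = 0) :
    -- sufficiency
    ((∀ μ ∈ unstableSpectrum (stateJacobian f), μ.im = 0) →
      LinearlyOpen f 0 →
      (∃ κ : ℝ, 0 < κ ∧ ENNReal.ofReal κ < cov f 0 ∧
        unstableBound (stateJacobian f) < (κ : EReal)) →
      ∃ u : EuclideanSpace ℝ (Fin n) → EuclideanSpace ℝ (Fin m),
        Continuous u ∧ LocallyExpStabilizes f u) ∧
    -- necessity, with no condition on the spectrum
    ((∃ u : EuclideanSpace ℝ (Fin n) → EuclideanSpace ℝ (Fin m),
        ContDiff ℝ 1 u ∧ LocallyExpStabilizes f u) →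
      LinearlyOpen f 0 ∧
        (Matrix.fromCols (stateJacobian f) (controlJacobian f)).rank = n) := by
  obtain ⟨W, hW, hfW⟩ := hf
  have hfc : ContDiffAt ℝ 1 f 0 := hfW.contDiffAt hW
  have hfd : DifferentiableAt ℝ f 0 := hfc.differentiableAt (by simp)
  constructor
  · rintro hreal - ⟨κ, hκ0, hκcov, hκ⟩
    obtain ⟨κ', hκ', hlt⟩ : ∃ κ', LinearlyOpenWith f 0 κ' ∧ κ < κ' := by
      simp only [cov, lt_iSup_iff] at hκcov
      obtain ⟨κ', hκ', hlt⟩ := hκcov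
      exact ⟨κ', hκ', (ENNReal.ofReal_lt_ofReal_iff_of_nonneg hκ0.le).1 hlt⟩
    have hspec : ∀ μ ∈ ((stateJacobian f).charpoly.map Complex.ofRealHom).roots, 0 ≤ μ.re →
        μ ∈ unstableSpectrum (stateJacobian f) := fun μ hμ hre => by
      refine ⟨?_, hre⟩
      have h := Polynomial.isRoot_of_mem_roots hμ
      rw [← Matrix.charpoly_map] at h
      exact Matrix.mem_spectrum_iff_isRoot_charpoly.2 h
    obtain ⟨K, hK⟩ := Matrix.exists_feedback_of_hautus (controlJacobian f) _ (stateJacobian f) rfl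
      (fun μ hμ hre => hreal μ (hspec μ hμ hre)) fun l hl p hp0 hp => by
        refine hκ'.vecMul_controlJacobian_ne_zero hfd hf0 hl (lt_trans ?_ hlt) hp0 hp
        have hroot : (l : ℂ) ∈ ((stateJacobian f).charpoly.map Complex.ofRealHom).roots := by
          rw [Polynomial.mem_roots ((Matrix.charpoly_monic _).map _).ne_zero, Polynomial.IsRoot.def,
            show (l : ℂ) = Complex.ofRealHom l from rfl, Polynomial.eval_map,
            Polynomial.eval₂_at_apply]
          have : (stateJacobian f).charpoly.eval l = 0 := by
            rw [Matrix.eval_charpoly, ← Matrix.exists_vecMul_eq_zero_iff]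
            refine ⟨p, hp0, ?_⟩
            rw [Matrix.vecMul_sub, hp, Matrix.scalar_apply, ← Matrix.smul_one_eq_diagonal,
              Matrix.vecMul_smul, Matrix.vecMul_one,
              sub_self]
          rw [this, map_zero]
        -- A nonnegative real left eigenvalue belongs to `Λ₊(A)`, hence lies below `κ` and so below
        -- the modulus `κ'`.
        have h := (le_sSup (mem_image_of_mem (fun μ : ℂ => (μ.re : EReal))
          (hspec _ hroot (by simpa using hl)))).trans_lt hκ
        simpa using h
    exact ⟨_, (Matrix.toEuclideanLin K).continuous_of_finiteDimensional,
      locallyExpStabilizes_of_forall_roots_re_neg hfc hf0 K hK⟩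
  · rintro ⟨u, hu, hstab⟩
    have hD := hfd.hasFDerivAt
    have hrange := hstab.range_fderiv_eq_top hD hf0 (hu.contDiffAt.differentiableAt (by simp))
    refine ⟨(hfc.hasStrictFDerivAt (by simp)).linearlyOpen hrange, ?_⟩
    have htop : LinearMap.range
        (Matrix.fromCols (stateJacobian f) (controlJacobian f)).mulVecLin = ⊤ := by
      rw [LinearMap.range_eq_top]
      intro y
      obtain ⟨z, hz⟩ := LinearMap.range_eq_top.1 hrange (WithLp.toLp 2 y)
      refine ⟨Sum.elim z.fst.ofLp z.snd.ofLp, ?_⟩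
      rw [Matrix.mulVecLin_apply, Matrix.fromCols_mulVec_sumElim, ← ofLp_fderiv_zero_apply hD]
      exact congrArg WithLp.ofLp hz
    rw [Matrix.rank, htop, finrank_top, Module.finrank_fin_fun]
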